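/- **Conventions.** Let $E$ be a (real) vector lattice. Elements $x,y\in E$ are disjoint, $x\perp y$, if $|x|\wedge|y|=0$, and $y$ is a fragment of $x$, $y\sqsubseteq x$, if $y\perp x-y$. For $S\subset E$ put $S^{\perp}=\{x\in E: x\perp y \text{ for all } y\in S\}$. A band $B$ is a solid linear subspace closed under all suprema existing in $E$; it is a projection band if $E=B+B^{\perp}$; $E$ has the projection property if every band in $E$ is a projection band. An atom is an element $u\neq 0$ such that $0\le x\le|u|$, $0\le y\le|u|$, $x\wedge y=0$ imply $x=0$ or $y=0$. A sequence converges laterally, $x_n\xrightarrow{\mathrm{lat}}x$, if $x_n\sqsubseteq x_m\sqsubseteq x$ for $n<m$ and $x_n\to x$ in order. Let $\mathcal U_{\sigma c}(E,\mathbb R)$ be the vector lattice of all maps $T:E\to\mathbb R$ that are orthogonally additive ($T(x+y)=T(x)+T(y)$ whenever $x\perp y$), order bounded (order bounded sets have bounded images) and $\sigma$-laterally continuous ($x_n\xrightarrow{\mathrm{lat}}x$ implies $T(x_n)\to T(x)$), ordered by $S\le T\iff S(x)\le T(x)$ for all $x\in E$. For a vector lattice $L$, let $\Phi_1(L)$ be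 the set of its finite elements, that is, of all $\varphi\in L$ for which there is $z\in L$ such that for each $x\in L$ there is $c_x>0$ with $|x|\wedge n|\varphi|\le c_x z$ for all $n\in\mathbb N$. Call a set $A$ nonmeasurable if every countably complete ultrafilter on $A$ is principal. (Every set of cardinality at most the continuum is nonmeasurable; all sets are nonmeasurable if there are no measurable cardinals, which is consistent with ZFC.) **Theorem.** Let $E$ be a vector lattice with the projection property in which every order bounded set of pairwise disjoint positive elements is nonmeasurable, and let $\varphi\in\Phi_1(\mathcal U_{\sigma c}(E,\mathbb R))$. Then there are finitely many (possibly no) pairwise disjoint atoms $e_1,\dots,e_n$ of $E$ such that the band $M$ generated by $e_1,\dots,e_n$ is a finite-dimensional projection band and $\varphi(x)=0$ for every $x\in M^{\perp}$. -/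

import Mathlib

open Filter Topology


/-! ### Vector lattices: disjointness, fragments, bands, atoms -/

namespace VL

section Defs

variable {E : Type*} [AddCommGroup E] [Lattice E]

/-- `x ⟂ y`: the elements `x` and `y` of a vector lattice are disjoint. -/
def Disj (x y : E) : Prop := |x| ⊓ |y| = 0

/-- `y ⊑ x`: `y` is a fragment (component) of `x`. -/
def IsFragment (y x : E) : Prop := Disj y (x - y)

/-- The disjoint complement of a set. -/
def disjCompl (S : Set E) : Set E := {x | ∀ y ∈ S, Disj x y}

/-- Order convergence of a sequence: `|x n - a|` is dominated by a sequence decreasing to `0`. -/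
def OrderConv (x : ℕ → E) (a : E) : Prop :=
  ∃ r : ℕ → E, Antitone r ∧ IsGLB (Set.range r) 0 ∧ ∀ n, |x n - a| ≤ r n

/-- Lateral convergence of a sequence: `x n ⊑ x m ⊑ a` for `n < m`, and `x n → a` in order. -/
def LatConv (x : ℕ → E) (a : E) : Prop :=
  (∀ n m, n < m → IsFragment (x n) (x m)) ∧ (∀ n, IsFragment (x n) a) ∧ OrderConv x a

/-- An atom of a vector lattice. -/
def IsAtomElt (u : E) : Prop :=
  u ≠ 0 ∧ ∀ x y : E, 0 ≤ x → x ≤ |u| → 0 ≤ y → y ≤ |u| → x ⊓ y = 0 → x = 0 ∨ y = 0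

variable [Module ℝ E]

/-- A band: a solid linear subspace that contains every supremum, existing in `E`,
of a subset of itself. -/
def IsBand (B : Submodule ℝ E) : Prop :=
  LatticeOrderedAddCommGroup.IsSolid (B : Set E) ∧
    ∀ (S : Set E) (x : E), S ⊆ (B : Set E) → IsLUB S x → x ∈ B

/-- A projection band: a band `B` with `E = B + B^⊥` (the sum is then direct). -/
def IsProjectionBand (B : Submodule ℝ E) : Prop :=
  IsBand B ∧ ∀ x : E, ∃ y ∈ B, ∃ z ∈ disjCompl (B : Set E), x = y + z

/-- The band generated by a set: the intersection of all bands that contain it. -/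
def bandGenerated (S : Set E) : Submodule ℝ E :=
  sInf {B : Submodule ℝ E | IsBand B ∧ S ⊆ (B : Set E)}

variable (E) in
/-- The projection property: every band is a projection band. -/
def ProjectionProperty : Prop := ∀ B : Submodule ℝ E, IsBand B → IsProjectionBand B

/-- A finite element `φ` of a vector lattice: there is `z` (a majorant of `φ`) such that for all `x`
there is `c > 0` with `|x| ∧ n|φ| ≤ c z` for all `n`. The set of finite elements of `E` is
denoted by `Φ₁(E)`. -/
def IsFiniteElement (φ : E) : Prop :=
  ∃ z : E, ∀ x : E, ∃ c : ℝ, 0 < c ∧ ∀ n : ℕ, |x| ⊓ n • |φ| ≤ c • z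

end Defs

/-- A set (type) is *nonmeasurable*, in the sense of measurable cardinals, if every countably
complete ultrafilter on it is principal. -/
def IsNonmeasurable (X : Type*) : Prop :=
  ∀ U : Ultrafilter X, CountableInterFilter (U : Filter X) → ∃ a : X, U = pure a

/-! ### Elementary facts on fragments -/

section Lemmas

variable {E : Type*} [AddCommGroup E] [Lattice E] [IsOrderedAddMonoid E]

theorem Disj.symm {x y : E} (h : Disj x y) : Disj y x := by
  unfold Disj at *; rwa [inf_comm]

theorem inf_zero_mono {a b x y : E} (ha : 0 ≤ a) (hb : 0 ≤ b) (hax : a ≤ x) (hby : b ≤ y)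
    (h : x ⊓ y = 0) : a ⊓ b = 0 :=
  le_antisymm ((inf_le_inf hax hby).trans h.le) (le_inf ha hb)

theorem Disj.mono {a b x y : E} (h : Disj x y) (ha : |a| ≤ |x|) (hb : |b| ≤ |y|) : Disj a b :=
  inf_zero_mono (abs_nonneg _) (abs_nonneg _) ha hb h

theorem add_inf_le_add {u v w : E} (hu : 0 ≤ u) (hv : 0 ≤ v) (hw : 0 ≤ w) :
    w ⊓ (u + v) ≤ w ⊓ u + w ⊓ v := by
  rw [inf_add, add_inf, add_inf]
  refine le_inf (le_inf ?_ ?_) (le_inf ?_ ?_)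
  · exact inf_le_left.trans (le_add_of_nonneg_left hw)
  · exact inf_le_left.trans (le_add_of_nonneg_right hv)
  · exact inf_le_left.trans (le_add_of_nonneg_left hu)
  · exact inf_le_right

theorem sup_eq_add_of_inf {u v : E} (h : u ⊓ v = 0) : u ⊔ v = u + v := by
  have := inf_add_sup u v
  rwa [h, zero_add] at this

theorem inf_add_of_inf {u v w : E} (hu : 0 ≤ u) (hv : 0 ≤ v) (hw : 0 ≤ w) (h : u ⊓ v = 0) :
    w ⊓ (u + v) = w ⊓ u + w ⊓ v := by
  refine le_antisymm (add_inf_le_add hu hv hw) (le_inf ?_ (add_le_add inf_le_right inf_le_right))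
  have h0 : (w ⊓ u) ⊓ (w ⊓ v) = 0 :=
    inf_zero_mono (le_inf hw hu) (le_inf hw hv) inf_le_right inf_le_right h
  rw [← sup_eq_add_of_inf h0]
  exact sup_le inf_le_left inf_le_left

theorem Disj.add_left {x y z : E} (hx : Disj x z) (hy : Disj y z) : Disj (x + y) z := by
  unfold Disj at *
  refine le_antisymm ?_ (le_inf (abs_nonneg _) (abs_nonneg _))
  rw [inf_comm]
  calc |z| ⊓ |x + y| ≤ |z| ⊓ (|x| + |y|) := inf_le_inf_left _ (abs_add_le x y)
    _ ≤ |z| ⊓ |x| + |z| ⊓ |y| := add_inf_le_add (abs_nonneg _) (abs_nonneg _) (abs_nonneg _)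
    _ = 0 := by rw [inf_comm |z| |x|, inf_comm |z| |y|, hx, hy, add_zero]

theorem Disj.add_right {x y z : E} (hx : Disj z x) (hy : Disj z y) : Disj z (x + y) :=
  (hx.symm.add_left hy.symm).symm

theorem bounds_of_abs_le {x w : E} (h : |x| ≤ w) : -w ≤ x ∧ x ≤ w :=
  ⟨neg_le.1 ((neg_le_abs x).trans h), (le_abs_self x).trans h⟩

theorem posPart_le_abs (x : E) : x⁺ ≤ |x| := by
  rw [← posPart_add_negPart]; exact le_add_of_nonneg_right (negPart_nonneg x)

theorem negPart_le_abs (x : E) : x⁻ ≤ |x| := by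
  rw [← posPart_add_negPart]; exact le_add_of_nonneg_left (posPart_nonneg x)

theorem posPart_eq_of_sub {x p q : E} (hx : x = p - q) (h : p ⊓ q = 0) : x⁺ = p := by
  have h1 : x⁺ = (p ⊔ q) - q := by
    rw [posPart_def, hx, sup_sub, sub_self]
  rw [h1, sup_eq_add_of_inf h, add_sub_cancel_right]

theorem Disj.posPart_add {a b : E} (h : Disj a b) : (a + b)⁺ = a⁺ + b⁺ := by
  refine posPart_eq_of_sub (q := a⁻ + b⁻) ?_ ?_
  · rw [add_sub_add_comm, posPart_sub_negPart, posPart_sub_negPart]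
  · have ha := posPart_nonneg a
    have hb := posPart_nonneg b
    have ha' := negPart_nonneg a
    have hb' := negPart_nonneg b
    have e1 : a⁺ ⊓ b⁻ = 0 := inf_zero_mono ha hb' (posPart_le_abs a) (negPart_le_abs b) h
    have e2 : b⁺ ⊓ a⁻ = 0 := inf_zero_mono hb ha' (posPart_le_abs b) (negPart_le_abs a) h.symm
    have e3 := posPart_inf_negPart_eq_zero a
    have e4 := posPart_inf_negPart_eq_zero b
    refine le_antisymm ?_ (le_inf (add_nonneg ha hb) (add_nonneg ha' hb'))
    have f1 : a⁺ ⊓ (a⁻ + b⁻) ≤ 0 :=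
      (add_inf_le_add ha' hb' ha).trans (by rw [e1, e3, add_zero])
    have f2 : b⁺ ⊓ (a⁻ + b⁻) ≤ 0 :=
      (add_inf_le_add ha' hb' hb).trans (by rw [e2, e4, add_zero])
    rw [inf_comm]
    refine (add_inf_le_add ha hb (add_nonneg ha' hb')).trans ?_
    rw [inf_comm _ a⁺, inf_comm _ b⁺]
    exact (add_le_add f1 f2).trans (add_zero 0).le

theorem Disj.neg {a b : E} (h : Disj a b) : Disj (-a) (-b) := by
  unfold Disj at *; rwa [abs_neg, abs_neg]

theorem Disj.negPart_add {a b : E} (h : Disj a b) : (a + b)⁻ = a⁻ + b⁻ := by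
  have := h.neg.posPart_add
  rwa [← neg_add, posPart_neg, posPart_neg, posPart_neg] at this

theorem IsFragment.posPart_le {y x : E} (h : IsFragment y x) : y⁺ ≤ x⁺ := by
  have := Disj.posPart_add h
  rw [add_sub_cancel] at this
  rw [this]; exact le_add_of_nonneg_right (posPart_nonneg _)

theorem IsFragment.negPart_le {y x : E} (h : IsFragment y x) : y⁻ ≤ x⁻ := by
  have := Disj.negPart_add h
  rw [add_sub_cancel] at this
  rw [this]; exact le_add_of_nonneg_right (negPart_nonneg _)

theorem IsFragment.abs_le {y x : E} (h : IsFragment y x) : |y| ≤ |x| := by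
  rw [← posPart_add_negPart, ← posPart_add_negPart]
  exact add_le_add h.posPart_le h.negPart_le

theorem IsFragment.compl {y x : E} (h : IsFragment y x) : IsFragment (x - y) x := by
  unfold IsFragment at *; rw [sub_sub_cancel]; exact h.symm

theorem isFragment_zero (x : E) : IsFragment 0 x := by
  unfold IsFragment Disj
  rw [abs_zero]; exact inf_eq_left.2 (abs_nonneg _)

/-- The common part of `y` and `a`; for two fragments of one element it is their intersection. -/
def common (y a : E) : E := y⁺ ⊓ a⁺ - y⁻ ⊓ a⁻

theorem common_comm (y a : E) : common y a = common a y := by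
  unfold common; rw [inf_comm, inf_comm y⁻]

theorem abs_common_le (y a : E) : |common y a| ≤ |y| := by
  have hp : 0 ≤ y⁺ ⊓ a⁺ := le_inf (posPart_nonneg _) (posPart_nonneg _)
  have hn : 0 ≤ y⁻ ⊓ a⁻ := le_inf (negPart_nonneg _) (negPart_nonneg _)
  unfold common
  rw [abs_le']
  constructor
  · exact (sub_le_self _ hn).trans (inf_le_left.trans (posPart_le_abs y))
  · rw [neg_sub]
    exact (sub_le_self _ hp).trans (inf_le_left.trans (negPart_le_abs y))

theorem abs_common_le' (y a : E) : |common y a| ≤ |a| := by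
  rw [common_comm]; exact abs_common_le a y

theorem common_add {y a b : E} (h : Disj a b) : common y (a + b) = common y a + common y b := by
  unfold common
  rw [h.posPart_add, h.negPart_add,
    inf_add_of_inf (posPart_nonneg _) (posPart_nonneg _) (posPart_nonneg _)
      (inf_zero_mono (posPart_nonneg _) (posPart_nonneg _) (posPart_le_abs a) (posPart_le_abs b) h),
    inf_add_of_inf (negPart_nonneg _) (negPart_nonneg _) (negPart_nonneg _)
      (inf_zero_mono (negPart_nonneg _) (negPart_nonneg _) (negPart_le_abs a) (negPart_le_abs b) h)]
  abel

theorem IsFragment.common_eq {y x : E} (h : IsFragment y x) : common y x = y := by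
  unfold common
  rw [inf_eq_left.2 h.posPart_le, inf_eq_left.2 h.negPart_le, posPart_sub_negPart]

/-- If `x = a ⊔ b` (disjoint sum) and `z` is a fragment of `x`, then `z` splits accordingly. -/
theorem IsFragment.split {z a b : E} (hab : Disj a b) (h : IsFragment z (a + b)) :
    z = common z a + common z b := by
  rw [← common_add hab, h.common_eq]

theorem isFragment_left {a b : E} (hab : Disj a b) : IsFragment a (a + b) := by
  unfold IsFragment; rwa [add_sub_cancel_left]

theorem IsFragment.common_isFragment {z a b : E} (hab : Disj a b) (h : IsFragment z (a + b)) :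
    IsFragment (common z a) a := by
  have h1 : a = common a z + common a (a + b - z) := by
    have e := common_add (y := a) h
    rw [add_sub_cancel, (isFragment_left hab).common_eq] at e
    exact e
  have h2 : a - common z a = common a (a + b - z) := by
    rw [common_comm z a]; exact sub_eq_of_eq_add' h1
  unfold IsFragment
  rw [h2]
  exact Disj.mono h (abs_common_le _ _) (abs_common_le' _ _)

theorem IsFragment.add {z w a b : E} (hab : Disj a b) (hz : IsFragment z a) (hw : IsFragment w b) :
    IsFragment (z + w) (a + b) := by
  unfold IsFragment
  rw [add_sub_add_comm]
  have h1 : Disj z (b - w) := hab.mono hz.abs_le hw.compl.abs_le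
  have h2 : Disj w (a - z) := hab.symm.mono hw.abs_le hz.compl.abs_le
  exact Disj.add_left (Disj.add_right hz h1) (Disj.add_right h2 hw)

theorem IsFragment.trans {z y x : E} (hz : IsFragment z y) (hy : IsFragment y x) :
    IsFragment z x := by
  have h := IsFragment.add hy hz (isFragment_zero (x - y))
  rwa [add_zero, add_sub_cancel] at h

/-- Intersecting a fragment of the limit with a laterally converging sequence. -/
theorem LatConv.common {x : ℕ → E} {a z : E} (hx : LatConv x a) (hz : IsFragment z a) :
    LatConv (fun n => common z (x n)) z := by
  obtain ⟨h1, h2, r, hr, hr0, hrx⟩ := hx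
  have key : ∀ n, z = VL.common z (x n) + VL.common z (a - x n) := fun n =>
    IsFragment.split (h2 n) (by rwa [add_sub_cancel])
  refine ⟨fun n m hnm => ?_, fun n => ?_, r, hr, hr0, fun n => ?_⟩
  · have e : VL.common z (x m) = VL.common z (x n) + VL.common z (x m - x n) := by
      rw [← common_add (h1 n m hnm), add_sub_cancel]
    show IsFragment _ _
    simp only [e]
    exact isFragment_left ((h1 n m hnm).mono (abs_common_le' _ _) (abs_common_le' _ _))
  · have e := isFragment_left
      ((h2 n).mono (abs_common_le' z (x n)) (abs_common_le' z (a - x n)))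
    rwa [← key n] at e
  · refine le_trans ?_ (hrx n)
    have e : VL.common z (x n) - z = -VL.common z (a - x n) := by
      rw [eq_neg_iff_add_eq_zero, sub_add_eq_add_sub, ← key n, sub_self]
    simp only [e]
    rw [abs_neg, abs_sub_comm (x n) a]
    exact abs_common_le' _ _

end Lemmas

/-- In `ℝ`, order convergence of sequences is ordinary convergence. -/
theorem orderConv_real_iff {x : ℕ → ℝ} {a : ℝ} : OrderConv x a ↔ Tendsto x atTop (𝓝 a) := by
  constructor
  · rintro ⟨r, hr, hr0, hx⟩
    have h : Tendsto r atTop (𝓝 0) := tendsto_atTop_isGLB hr hr0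
    rw [tendsto_iff_norm_sub_tendsto_zero]
    exact squeeze_zero (fun n => norm_nonneg _) hx h
  · intro h
    have h0 : Tendsto (fun n => |x n - a|) atTop (𝓝 0) := by
      simpa [Real.norm_eq_abs] using (tendsto_iff_norm_sub_tendsto_zero.1 h)
    have hbdd : ∀ n, BddAbove (Set.range fun k : ℕ => |x (n + k) - a|) := fun n =>
      h0.bddAbove_range.mono (by rintro _ ⟨k, rfl⟩; exact ⟨n + k, rfl⟩)
    refine ⟨fun n => ⨆ k : ℕ, |x (n + k) - a|, fun n m hnm => ?_, ⟨?_, ?_⟩, fun n => ?_⟩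
    · refine ciSup_le fun k => ?_
      have := le_ciSup (hbdd n) (m - n + k)
      simpa [show n + (m - n + k) = m + k by omega] using this
    · rintro _ ⟨n, rfl⟩
      exact Real.iSup_nonneg fun k => abs_nonneg _
    · intro b hb
      refine le_of_forall_pos_le_add fun ε hε => ?_
      obtain ⟨N, hN⟩ := (h0.eventually (gt_mem_nhds hε)).exists_forall_of_atTop
      refine (hb ⟨N, rfl⟩).trans ?_
      rw [zero_add]
      exact ciSup_le fun k => (hN (N + k) (Nat.le_add_right _ _)).le
    · have := le_ciSup (hbdd n) 0
      simpa using this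

/-! ### Abstract Uryson functionals -/

section Uryson

variable {E : Type*} [AddCommGroup E] [Lattice E]

/-- Orthogonally additive maps. -/
def OrthogonallyAdditive {X : Type*} [AddCommGroup X] (T : E → X) : Prop :=
  ∀ x y : E, Disj x y → T (x + y) = T x + T y

/-- Order bounded maps: order bounded sets have order bounded images. -/
def OrderBoundedMap {F : Type*} [Preorder F] (T : E → F) : Prop :=
  ∀ A : Set E, BddBelow A → BddAbove A → BddBelow (T '' A) ∧ BddAbove (T '' A)

/-- `σ`-laterally continuous maps. -/
def SigmaLaterallyContinuous {F : Type*} [AddCommGroup F] [Lattice F] (T : E → F) : Prop :=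
  ∀ (x : ℕ → E) (a : E), LatConv x a → OrderConv (fun n => T (x n)) (T a)

theorem sigmaLaterallyContinuous_iff {T : E → ℝ} : SigmaLaterallyContinuous T ↔
    ∀ (x : ℕ → E) (a : E), LatConv x a → Tendsto (fun n => T (x n)) atTop (𝓝 (T a)) := by
  simp only [SigmaLaterallyContinuous, orderConv_real_iff]

theorem orderBoundedMap_iff {T : E → ℝ} : OrderBoundedMap T ↔
    ∀ A : Set E, BddBelow A → BddAbove A → ∃ K : ℝ, ∀ x ∈ A, |T x| ≤ K := by
  refine forall_congr' fun A => forall_congr' fun _ => forall_congr' fun _ => ⟨?_, ?_⟩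
  · rintro ⟨⟨l, hl⟩, ⟨u, hu⟩⟩
    refine ⟨max |l| |u|, fun x hx => ?_⟩
    exact abs_le_max_abs_abs (hl ⟨x, hx, rfl⟩) (hu ⟨x, hx, rfl⟩)
  · rintro ⟨K, hK⟩
    refine ⟨⟨-K, ?_⟩, ⟨K, ?_⟩⟩
    · rintro _ ⟨x, hx, rfl⟩; exact (abs_le.1 (hK x hx)).1
    · rintro _ ⟨x, hx, rfl⟩; exact (abs_le.1 (hK x hx)).2

variable (E) in
/-- `𝒰_{σc}(E, ℝ)`: the vector space of `σ`-laterally continuous abstract Uryson functionals, that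
is, orthogonally additive, order bounded and `σ`-laterally continuous maps `E → ℝ`. Its order
`S ≤ T ↔ ∀ x, S x ≤ T x` is the pointwise one, inherited from `E → ℝ` (its lattice operations are
not pointwise). -/
def UrysonSC : Submodule ℝ (E → ℝ) where
  carrier := {T | OrthogonallyAdditive T ∧ OrderBoundedMap T ∧ SigmaLaterallyContinuous T}
  zero_mem' := by
    refine ⟨fun x y _ => by simp, orderBoundedMap_iff.2 fun A _ _ => ⟨0, fun x _ => by simp⟩,
      sigmaLaterallyContinuous_iff.2 fun x a _ => ?_⟩
    simp
  add_mem' := by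
    rintro S T ⟨hS1, hS2, hS3⟩ ⟨hT1, hT2, hT3⟩
    refine ⟨fun x y h => ?_, orderBoundedMap_iff.2 fun A h1 h2 => ?_,
      sigmaLaterallyContinuous_iff.2 fun x a h => ?_⟩
    · simp only [Pi.add_apply, hS1 x y h, hT1 x y h]; ring
    · obtain ⟨K, hK⟩ := orderBoundedMap_iff.1 hS2 A h1 h2
      obtain ⟨L, hL⟩ := orderBoundedMap_iff.1 hT2 A h1 h2
      exact ⟨K + L, fun x hx => (abs_add_le _ _).trans (add_le_add (hK x hx) (hL x hx))⟩
    · exact (sigmaLaterallyContinuous_iff.1 hS3 x a h).add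
        (sigmaLaterallyContinuous_iff.1 hT3 x a h)
  smul_mem' := by
    rintro c T ⟨hT1, hT2, hT3⟩
    refine ⟨fun x y h => ?_, orderBoundedMap_iff.2 fun A h1 h2 => ?_,
      sigmaLaterallyContinuous_iff.2 fun x a h => ?_⟩
    · simp only [Pi.smul_apply, hT1 x y h, smul_add]
    · obtain ⟨L, hL⟩ := orderBoundedMap_iff.1 hT2 A h1 h2
      refine ⟨|c| * L, fun x hx => ?_⟩
      rw [Pi.smul_apply, smul_eq_mul, abs_mul]
      exact mul_le_mul_of_nonneg_left (hL x hx) (abs_nonneg c)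
    · exact (sigmaLaterallyContinuous_iff.1 hT3 x a h).const_smul c

/-- The positive part of `T` in the order of `𝒰_{σc}(E, ℝ)`: `T⁺ x = sup {T z : z ⊑ x}`. -/
noncomputable def urysonPos (T : E → ℝ) (x : E) : ℝ := sSup (T '' {z | IsFragment z x})

variable [IsOrderedAddMonoid E]

theorem bddAbove_urysonPos {T : E → ℝ} (hT : OrderBoundedMap T) (x : E) :
    BddAbove (T '' {z | IsFragment z x}) :=
  (hT {z | IsFragment z x} ⟨-|x|, fun _ hz => (bounds_of_abs_le (IsFragment.abs_le hz)).1⟩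
    ⟨|x|, fun _ hz => (bounds_of_abs_le (IsFragment.abs_le hz)).2⟩).2

theorem le_urysonPos {T : E → ℝ} (hT : OrderBoundedMap T) {z x : E} (h : IsFragment z x) :
    T z ≤ urysonPos T x :=
  le_csSup (bddAbove_urysonPos hT x) ⟨z, h, rfl⟩

theorem urysonPos_le {T : E → ℝ} {x : E} {K : ℝ} (h : ∀ z, IsFragment z x → T z ≤ K) :
    urysonPos T x ≤ K := by
  refine csSup_le ⟨T 0, 0, isFragment_zero x, rfl⟩ ?_
  rintro _ ⟨z, hz, rfl⟩
  exact h z hz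

theorem urysonPos_mem {T : E → ℝ} (hT : T ∈ UrysonSC E) : urysonPos T ∈ UrysonSC E := by
  obtain ⟨h1, h2, h3⟩ := hT
  have h0 : T 0 = 0 := by
    have := h1 0 0 (by simp [Disj])
    simpa using this
  have hnn : ∀ x, 0 ≤ urysonPos T x := fun x => by
    rw [← h0]; exact le_urysonPos h2 (isFragment_zero x)
  refine ⟨fun a b hab => le_antisymm ?_ ?_, orderBoundedMap_iff.2 fun A hl hu => ?_,
    sigmaLaterallyContinuous_iff.2 fun x a hx => ?_⟩
  · refine urysonPos_le fun z hz => ?_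
    have hz' : IsFragment z (b + a) := by rwa [add_comm]
    rw [hz.split hab, h1 _ _ (hab.mono (abs_common_le' _ _) (abs_common_le' _ _))]
    exact add_le_add (le_urysonPos h2 (hz.common_isFragment hab))
      (le_urysonPos h2 (hz'.common_isFragment hab.symm))
  · rw [← le_sub_iff_add_le]
    refine urysonPos_le fun z hz => ?_
    rw [le_sub_comm]
    refine urysonPos_le fun w hw => ?_
    rw [le_sub_iff_add_le', ← h1 z w (hab.mono hz.abs_le hw.abs_le)]
    exact le_urysonPos h2 (hz.add hab hw)
  · obtain ⟨l, hl⟩ := hl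
    obtain ⟨u, hu⟩ := hu
    obtain ⟨K, hK⟩ := orderBoundedMap_iff.1 h2 (Set.Icc (-(|l| ⊔ |u|)) (|l| ⊔ |u|))
      bddBelow_Icc bddAbove_Icc
    refine ⟨K, fun x hx => ?_⟩
    rw [abs_of_nonneg (hnn x)]
    refine urysonPos_le fun z hz => (le_abs_self _).trans (hK z ?_)
    have hxw : |x| ≤ |l| ⊔ |u| := by
      rw [abs_le']
      constructor
      · exact (hu hx).trans ((le_abs_self u).trans le_sup_right)
      · exact (neg_le_neg (hl hx)).trans ((neg_le_abs l).trans le_sup_left)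
    exact bounds_of_abs_le (hz.abs_le.trans hxw)
  · have hle : ∀ n, urysonPos T (x n) ≤ urysonPos T a := fun n =>
      urysonPos_le fun z hz => le_urysonPos h2 (hz.trans (hx.2.1 n))
    refine tendsto_order.2 ⟨fun b hb => ?_, fun b hb => Eventually.of_forall fun n =>
      (hle n).trans_lt hb⟩
    obtain ⟨_, ⟨z, hz, rfl⟩, hbz⟩ := exists_lt_of_lt_csSup
      (⟨T 0, 0, isFragment_zero a, rfl⟩ : (T '' {z | IsFragment z a}).Nonempty) hb
    have ht := sigmaLaterallyContinuous_iff.1 h3 _ _ (hx.common hz)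
    filter_upwards [ht.eventually (lt_mem_nhds hbz)] with n hn
    refine hn.trans_le (le_urysonPos h2 ?_)
    have hz' : IsFragment z (x n + (a - x n)) := by rwa [add_sub_cancel]
    exact hz'.common_isFragment (hx.2.1 n)

/-- The vector lattice structure of `𝒰_{σc}(E, ℝ)`, for the pointwise order:
`S ∨ T = S + (T - S)⁺` and `S ∧ T = -((-S) ∨ (-T))`. -/
noncomputable instance : Lattice (UrysonSC E) :=
  let sup : UrysonSC E → UrysonSC E → UrysonSC E := fun S T =>
    S + ⟨urysonPos ((T - S : UrysonSC E) : E → ℝ), urysonPos_mem (T - S).2⟩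
  have hzero : ∀ S : UrysonSC E, (S : E → ℝ) 0 = 0 := fun S => by
    have := S.2.1 0 0 (by simp [Disj])
    simpa using this
  have hleft : ∀ S T : UrysonSC E, S ≤ sup S T := fun S T x => by
    have h := le_urysonPos (T - S).2.2.1 (isFragment_zero x)
    rw [hzero] at h
    exact le_add_of_nonneg_right h
  have hright : ∀ S T : UrysonSC E, T ≤ sup S T := fun S T x => by
    have hx : IsFragment x x := by
      have := (isFragment_zero x).compl
      rwa [sub_zero] at this
    have h := le_urysonPos (T - S).2.2.1 hx
    exact sub_le_iff_le_add'.1 h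
  have hleast : ∀ S T R : UrysonSC E, S ≤ R → T ≤ R → sup S T ≤ R := fun S T R hS hT x => by
    have h : urysonPos ((T - S : UrysonSC E) : E → ℝ) x ≤ (R : E → ℝ) x - (S : E → ℝ) x := by
      refine urysonPos_le fun z hz => ?_
      have e1 := S.2.1 z (x - z) hz
      have e2 := R.2.1 z (x - z) hz
      rw [add_sub_cancel] at e1 e2
      have e3 : (T : E → ℝ) z ≤ (R : E → ℝ) z := hT z
      have e4 : (S : E → ℝ) (x - z) ≤ (R : E → ℝ) (x - z) := hS (x - z)
      show (T : E → ℝ) z - (S : E → ℝ) z ≤ _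
      linarith
    exact le_sub_iff_add_le'.1 h
  { (inferInstance : PartialOrder (UrysonSC E)) with
    sup := sup
    le_sup_left := hleft
    le_sup_right := hright
    sup_le := hleast
    inf := fun S T => -sup (-S) (-T)
    inf_le_left := fun S T => neg_le.1 (hleft (-S) (-T))
    inf_le_right := fun S T => neg_le.1 (hright (-S) (-T))
    le_inf := fun R S T h1 h2 => le_neg.1 (hleast _ _ _ (neg_le_neg h1) (neg_le_neg h2)) }

end Uryson

end VL

/-!
Let `z` be a majorant of `φ` and put `p = |φ|`. For `g ∈ E` let `p_g` be the part of `p`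
carried by the fragments of `g`. Whenever `S = ∑ tₖ p_{gₖ}` is again a functional, testing the
majorant on `S` gives `tₖ p gₖ ≤ c z gₖ` with a constant `c` independent of `k`. Summing with
geometrically decreasing values `tₖ p gₖ` shows that `z ≥ δ > 0` wherever `p > 0`. For disjoint
atoms `uₖ` with `p uₖ > 0` this makes every sum `∑ tₖ p_{uₖ}` locally finite, so the values
`tₖ p uₖ` could be chosen to grow faster than `z uₖ`: there are only finitely many such atoms.

Conversely, every `x` with `p x > 0` has an atomic fragment `u` with `p u > 0`. As `z ≥ δ` on
non-null elements, splitting `x` into two non-null fragments can be repeated only finitely often,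
which leaves a non-null fragment `f` on which `p` is two-valued. On a maximal disjoint family `A`
of null fragments of `f`, the subsets with null complement would form a nonprincipal ultrafilter if
`p` were not null on the band generated by `A`, and `σ`-lateral continuity makes it countably
complete. By nonmeasurability `p` is therefore null on that band, and the component of `f` disjoint
from `A` has no nonzero null fragments, so it is an atom.
-/

namespace VL

/-! ### Disjointness and fragments -/

section Disjointness

variable {E : Type*} [AddCommGroup E] [Lattice E]

theorem disj_neg_right {x y : E} : Disj x (-y) ↔ Disj x y := by
  simp only [Disj, abs_neg]

theorem disjCompl_anti {S T : Set E} (h : S ⊆ T) : disjCompl T ⊆ disjCompl S :=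
  fun _ hx y hy => hx y (h hy)

theorem abs_smul_le [Module ℝ E] [IsOrderedModule ℝ E] (c : ℝ) (y : E) : |c • y| ≤ |c| • |y| := by
  have hle (d : ℝ) : d • y ≤ |d| • |y| := by
    rcases le_total 0 d with hd | hd
    · rw [abs_of_nonneg hd]
      exact smul_le_smul_of_nonneg_left (le_abs_self y) hd
    · rw [abs_of_nonpos hd, ← neg_smul_neg]
      exact smul_le_smul_of_nonneg_left (neg_le_abs y) (neg_nonneg.2 hd)
  refine abs_le'.2 ⟨hle c, ?_⟩
  rw [← neg_smul, ← abs_neg c]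
  exact hle (-c)

variable [IsOrderedAddMonoid E]

theorem disj_abs_right {x y : E} : Disj x |y| ↔ Disj x y := by
  simp only [Disj, abs_abs]

theorem disj_zero_right (x : E) : Disj x 0 := by
  simp only [Disj, abs_zero, inf_eq_right, abs_nonneg]

theorem Disj.sub_right {x y z : E} (hx : Disj z x) (hy : Disj z y) : Disj z (x - y) := by
  rw [sub_eq_add_neg]
  exact hx.add_right (disj_neg_right.2 hy)

theorem disj_sum_right {ι : Type*} {s : Finset ι} {u : ι → E} {x : E}
    (h : ∀ i ∈ s, Disj x (u i)) : Disj x (∑ i ∈ s, u i) :=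
  Finset.sum_induction _ (Disj x) (fun _ _ => Disj.add_right) (disj_zero_right x) h

theorem Disj.nsmul_right {x y : E} (h : Disj x y) (n : ℕ) : Disj x (n • y) := by
  simpa only [Finset.sum_const, Finset.card_range] using
    disj_sum_right (s := Finset.range n) (u := fun _ => y) fun _ _ => h

theorem Disj.eq_zero {x : E} (h : Disj x x) : x = 0 := by
  obtain ⟨h₁, h₂⟩ := bounds_of_abs_le ((inf_idem _).symm.trans h).le
  exact le_antisymm h₂ (neg_zero.symm.trans_le h₁)

theorem eq_zero_of_abs_eq_zero {x : E} (h : |x| = 0) : x = 0 :=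
  Disj.eq_zero (by rw [Disj, h, inf_idem])

theorem Disj.eq_zero_of_abs_le {x y : E} (h : Disj x y) (hxy : |x| ≤ |y|) : x = 0 :=
  (h.mono le_rfl hxy).eq_zero

theorem abs_sum_le_of_disj {ι : Type*} {s : Finset ι} {u : ι → E}
    (hd : (s : Set ι).Pairwise fun i j => Disj (u i) (u j)) {w : E} (hw₀ : 0 ≤ w)
    (hw : ∀ i ∈ s, |u i| ≤ w) : |∑ i ∈ s, u i| ≤ w := by
  classical
  induction s using Finset.induction_on with
  | empty => simpa
  | insert i s hi ih =>
    rw [Finset.coe_insert, Set.pairwise_insert_of_notMem (by simpa using hi)] at hd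
    rw [Finset.forall_mem_insert] at hw
    have hdisj : Disj (u i) (∑ j ∈ s, u j) := disj_sum_right fun j hj => (hd.2 j hj).1
    calc |∑ j ∈ insert i s, u j| = |u i + ∑ j ∈ s, u j| := by rw [Finset.sum_insert hi]
      _ ≤ |u i| + |∑ j ∈ s, u j| := abs_add_le _ _
      _ = |u i| ⊔ |∑ j ∈ s, u j| := (sup_eq_add_of_inf hdisj).symm
      _ ≤ w := sup_le hw.1 (ih hd.1 hw.2)

theorem IsFragment.refl (x : E) : IsFragment x x := by
  simpa only [sub_zero] using (isFragment_zero x).compl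

theorem isFragment_right {a b : E} (h : Disj a b) : IsFragment b (a + b) :=
  add_comm a b ▸ isFragment_left h.symm

theorem IsFragment.sub_of_disj {x a b : E} (hb : IsFragment b x) (h : Disj b a) :
    IsFragment b (x - a) := by
  unfold IsFragment at *
  rw [sub_right_comm]
  exact hb.sub_right h

theorem IsFragment.add_of_disj {x a b : E} (ha : IsFragment a x) (hb : IsFragment b x)
    (h : Disj a b) : IsFragment (a + b) x := by
  simpa only [add_sub_cancel] using IsFragment.add ha (.refl a) (hb.sub_of_disj h.symm)

theorem IsFragment.sub_right {x y z : E} (hyz : IsFragment y z) (hzx : IsFragment z x) :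
    IsFragment (z - y) (x - y) :=
  (hyz.compl.trans hzx).sub_of_disj hyz.symm

theorem IsFragment.sub_left {x y z : E} (hyz : IsFragment y z) (hzx : IsFragment z x) :
    IsFragment (x - z) (x - y) :=
  hzx.compl.sub_of_disj (hzx.symm.mono le_rfl hyz.abs_le)

theorem IsFragment.common_left {x y z : E} (hy : IsFragment y x) (hz : IsFragment z x) :
    IsFragment (common y z) y := by
  rw [← add_sub_cancel z x] at hy
  have hdisj : Disj (common y z) (common y (x - z)) :=
    hz.mono (abs_common_le' _ _) (abs_common_le' _ _)
  simpa only [← hy.split hz] using isFragment_left hdisj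

theorem IsFragment.common_right {x y z : E} (hy : IsFragment y x) (hz : IsFragment z x) :
    IsFragment (common y z) z :=
  common_comm y z ▸ hz.common_left hy

theorem disjCompl_solid {S : Set E} {x y : E} (hy : y ∈ disjCompl S) (h : |x| ≤ |y|) :
    x ∈ disjCompl S :=
  fun a ha => (hy a ha).mono h le_rfl

theorem subset_disjCompl_disjCompl (S : Set E) : S ⊆ disjCompl (disjCompl S) :=
  fun _ hx _ hy => (hy _ hx).symm

theorem mem_disjCompl_disjCompl_of_union {S T : Set E} {x : E}
    (hx : x ∈ disjCompl (disjCompl (S ∪ T))) (hT : x ∈ disjCompl T) :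
    x ∈ disjCompl (disjCompl S) := by
  intro y hy
  have habs : |(|x| ⊓ |y|)| = |x| ⊓ |y| := abs_of_nonneg (le_inf (abs_nonneg _) (abs_nonneg _))
  have hmem : |x| ⊓ |y| ∈ disjCompl (S ∪ T) := by
    rintro a (ha | ha)
    · exact disjCompl_solid hy (habs.trans_le inf_le_right) a ha
    · exact disjCompl_solid hT (habs.trans_le inf_le_left) a ha
  exact (hx _ hmem).symm.eq_zero_of_abs_le (habs.trans_le inf_le_left)

theorem exists_maximal_pairwise_disj (N : Set E) :
    ∃ A ⊆ N, A.Pairwise Disj ∧ ∀ x ∈ N, x ∈ disjCompl A → x = 0 := by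
  obtain ⟨A, hA⟩ := zorn_subset {A : Set E | A ⊆ N ∧ A.Pairwise Disj} fun c hc hchain =>
    ⟨⋃₀ c, ⟨Set.sUnion_subset fun s hs => (hc hs).1,
      (Set.pairwise_sUnion hchain.directedOn).2 fun s hs => (hc hs).2⟩,
      fun _ => Set.subset_sUnion_of_mem⟩
  refine ⟨A, hA.prop.1, hA.prop.2, fun x hxN hxA => ?_⟩
  have hins : (insert x A).Pairwise Disj :=
    Set.pairwise_insert.2 ⟨hA.prop.2, fun a ha _ => ⟨hxA a ha, (hxA a ha).symm⟩⟩
  have hmem : x ∈ A := hA.mem_of_prop_insert ⟨Set.insert_subset hxN hA.prop.1, hins⟩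
  exact (hxA x hmem).eq_zero

theorem latConv_of_isGLB {b : ℕ → E} {g : E} (hb : ∀ n m, n < m → IsFragment (b n) (b m))
    (hbg : ∀ n, IsFragment (b n) g) (h : IsGLB (Set.range fun n => |g - b n|) 0) :
    LatConv b g := by
  refine ⟨hb, hbg, fun n => |g - b n|, fun n m hnm => ?_, h, fun n => (abs_sub_comm _ _).le⟩
  rcases hnm.eq_or_lt with rfl | hlt
  · exact le_rfl
  · exact ((hb n m hlt).sub_left (hbg m)).abs_le

theorem Disj.smul_right [Module ℝ E] [IsOrderedModule ℝ E] {x y : E} (h : Disj x y)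
    (c : ℝ) : Disj x (c • y) := by
  obtain ⟨n, hn⟩ := exists_nat_ge |c|
  refine ((disj_abs_right.2 h).nsmul_right n).mono le_rfl ?_
  rw [abs_of_nonneg (nsmul_nonneg (abs_nonneg y) n), ← Nat.cast_smul_eq_nsmul ℝ]
  exact (abs_smul_le c y).trans (smul_le_smul_of_nonneg_right hn (abs_nonneg y))

end Disjointness

/-! ### Bands and atoms under the projection property -/

section Bands

variable {E : Type*} [AddCommGroup E] [Lattice E]

theorem isBand_bandGenerated [Module ℝ E] (S : Set E) : IsBand (bandGenerated S) := by
  refine ⟨fun x hx y hyx => ?_, fun T x hT hx => ?_⟩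
  · exact Submodule.mem_sInf.2 fun B hB => hB.1.1 (Submodule.mem_sInf.1 hx B hB) hyx
  · exact Submodule.mem_sInf.2 fun B hB =>
      hB.1.2 T x (fun t ht => Submodule.mem_sInf.1 (hT ht) B hB) hx

theorem subset_bandGenerated [Module ℝ E] (S : Set E) : S ⊆ (bandGenerated S : Set E) :=
  fun _ hx => Submodule.mem_sInf.2 fun _ hB => hB.2 hx

variable [IsOrderedAddMonoid E]

theorem isLUB_empty_eq_zero {x : E} (h : IsLUB (∅ : Set E) x) : x = 0 := by
  have hle (y : E) : x ≤ y := h.2 (by simp)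
  exact le_antisymm (hle 0) (by simpa using hle (x + x))

theorem disj_posPart_left_of_isLUB {A : Set E} {x y : E} (hx : IsLUB A x)
    (hA : ∀ a ∈ A, Disj a y) : Disj x⁺ y := by
  have hd₀ : 0 ≤ x⁺ ⊓ |y| := le_inf (posPart_nonneg _) (abs_nonneg _)
  have hub (a : E) (ha : a ∈ A) : a ≤ x⁺ - x⁺ ⊓ |y| := by
    have hdisj : a⁺ ⊓ (x⁺ ⊓ |y|) = 0 :=
      inf_zero_mono (posPart_nonneg _) hd₀ (posPart_le_abs a) inf_le_right (hA a ha)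
    refine (le_posPart a).trans (le_sub_iff_add_le.2 ?_)
    rw [← sup_eq_add_of_inf hdisj]
    exact sup_le (posPart_mono (hx.1 ha)) inf_le_left
  have hle : x⁺ ≤ x⁺ - x⁺ ⊓ |y| := sup_le (hx.2 hub) (sub_nonneg.2 inf_le_left)
  unfold Disj
  rw [abs_of_nonneg (posPart_nonneg x)]
  exact le_antisymm (by simpa using hle) hd₀

theorem disj_negPart_left_of_le {a x y : E} (hax : a ≤ x) (ha : Disj a y) : Disj x⁻ y := by
  refine ha.mono ?_ le_rfl
  rw [abs_of_nonneg (negPart_nonneg x)]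
  exact (sup_le_sup_right (neg_le_neg hax) 0).trans (negPart_le_abs a)

theorem IsAtomElt.abs_eq {u : E} (hu : IsAtomElt u) : |u| = u ∨ |u| = -u := by
  rcases hu.2 u⁺ u⁻ (posPart_nonneg u) (posPart_le_abs u) (negPart_nonneg u) (negPart_le_abs u)
    (posPart_inf_negPart_eq_zero u) with h | h
  · exact .inr (abs_of_nonpos (posPart_eq_zero.1 h))
  · exact .inl (abs_of_nonneg (negPart_eq_zero.1 h))

theorem IsAtomElt.eq_zero_or_eq {u f : E} (hu : IsAtomElt u) (hf : IsFragment f u) :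
    f = 0 ∨ f = u := by
  exact (hu.2 |f| |u - f| (abs_nonneg _) hf.abs_le (abs_nonneg _) hf.compl.abs_le hf).imp
    eq_zero_of_abs_eq_zero fun h => (sub_eq_zero.1 (eq_zero_of_abs_eq_zero h)).symm

variable [Module ℝ E] [IsOrderedModule ℝ E]

/-- The disjoint complement of a set, as a linear subspace. -/
def disjComplSubmodule (S : Set E) : Submodule ℝ E where
  carrier := disjCompl S
  zero_mem' := fun y _ => (disj_zero_right y).symm
  add_mem' := fun ha hb y hy => (ha y hy).add_left (hb y hy)
  smul_mem' := fun c _ hx y hy => ((hx y hy).symm.smul_right c).symm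

theorem isBand_disjComplSubmodule (S : Set E) : IsBand (disjComplSubmodule S) := by
  refine ⟨fun x hx y hyx => disjCompl_solid hx hyx, fun A x hA hx y hy => ?_⟩
  rcases A.eq_empty_or_nonempty with rfl | ⟨a, ha⟩
  · rw [isLUB_empty_eq_zero hx]
    exact (disj_zero_right y).symm
  · have hpos : Disj x⁺ y := disj_posPart_left_of_isLUB hx fun a ha => hA ha y hy
    have hneg : Disj x⁻ y := disj_negPart_left_of_le (hx.1 ha) (hA ha y hy)
    rw [← posPart_sub_negPart x]
    exact (hpos.symm.sub_right hneg.symm).symm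

theorem bandGenerated_subset_disjCompl_disjCompl (S : Set E) :
    (bandGenerated S : Set E) ⊆ disjCompl (disjCompl S) :=
  fun _ hx => Submodule.mem_sInf.1 hx (disjComplSubmodule (disjCompl S))
    ⟨isBand_disjComplSubmodule _, subset_disjCompl_disjCompl S⟩

theorem ProjectionProperty.exists_add_eq (hE : ProjectionProperty E) (S : Set E) (x : E) :
    ∃ a ∈ disjCompl S, ∃ b ∈ disjCompl (disjCompl S), Disj a b ∧ a + b = x := by
  obtain ⟨a, ha, b, hb, rfl⟩ := (hE _ (isBand_disjComplSubmodule S)).2 x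
  exact ⟨a, ha, b, hb, (hb a ha).symm, rfl⟩

/-- The elements that are infinitely small with respect to `y`. In a vector lattice with the
projection property this band is zero, which gives the Archimedean property. -/
def infinitesimals (y : E) (hy : 0 ≤ y) : Submodule ℝ E where
  carrier := {x | ∀ c : ℝ, 0 < c → |x| ≤ c • y}
  zero_mem' := fun c hc => by
    rw [abs_zero]
    exact smul_nonneg hc.le hy
  add_mem' := fun {a b} ha hb c hc => by
    have hle := add_le_add (ha (c / 2) (half_pos hc)) (hb (c / 2) (half_pos hc))
    rw [← add_smul, add_halves] at hle
    exact (abs_add_le a b).trans hle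
  smul_mem' := fun d x hx c hc => by
    have hd : 0 < |d| + 1 := by positivity
    calc |d • x| ≤ |d| • |x| := abs_smul_le d x
      _ ≤ |d| • (c / (|d| + 1)) • y :=
        smul_le_smul_of_nonneg_left (hx _ (div_pos hc hd)) (abs_nonneg d)
      _ = (|d| * (c / (|d| + 1))) • y := smul_smul _ _ _
      _ ≤ c • y := by
        refine smul_le_smul_of_nonneg_right ?_ hy
        rw [mul_div_left_comm]
        exact mul_le_of_le_one_right hc.le ((div_le_one hd).2 (by linarith))

theorem isBand_infinitesimals (y : E) (hy : 0 ≤ y) : IsBand (infinitesimals y hy) := by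
  refine ⟨fun x hx z hzx c hc => hzx.trans (hx c hc), fun A x hA hx c hc => ?_⟩
  rcases A.eq_empty_or_nonempty with rfl | ⟨a, ha⟩
  · rw [isLUB_empty_eq_zero hx, abs_zero]
    exact smul_nonneg hc.le hy
  · have hle : x ≤ c • y := hx.2 fun a ha => (le_abs_self a).trans (hA ha c hc)
    have hneg : -x ≤ c • y :=
      (neg_le_neg (hx.1 ha)).trans ((neg_le_abs a).trans (hA ha c hc))
    exact abs_le'.2 ⟨hle, hneg⟩

theorem ProjectionProperty.eq_zero_of_forall_abs_le_smul (hE : ProjectionProperty E) {x y : E}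
    (h : ∀ c : ℝ, 0 < c → |x| ≤ c • y) : x = 0 := by
  have hxy : |x| ≤ y := by simpa only [one_smul] using h 1 one_pos
  have hy : 0 ≤ y := (abs_nonneg x).trans hxy
  obtain ⟨a, ha, b, hb, rfl⟩ := (hE _ (isBand_infinitesimals y hy)).2 y
  have hle : |a| ≤ |b| := by
    have htwo : (2 : ℝ) • |a| ≤ a + b := by
      simpa [smul_smul] using smul_le_smul_of_nonneg_left (ha 2⁻¹ (by norm_num))
        (zero_le_two (α := ℝ))
    rw [two_smul] at htwo
    exact le_of_add_le_add_left (htwo.trans ((le_abs_self _).trans (abs_add_le a b)))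
  obtain rfl : a = 0 := (hb a ha).symm.eq_zero_of_abs_le hle
  rw [zero_add] at hxy
  exact (hb x h).symm.eq_zero_of_abs_le (hxy.trans (le_abs_self b))

theorem ProjectionProperty.le_of_forall_le_add_smul (hE : ProjectionProperty E) {x y w : E}
    (hw : 0 ≤ w) (h : ∀ c : ℝ, 0 < c → x ≤ y + c • w) : x ≤ y := by
  have hpos : (x - y)⁺ = 0 := hE.eq_zero_of_forall_abs_le_smul (y := w) fun c hc => by
    rw [abs_of_nonneg (posPart_nonneg _)]
    exact sup_le (sub_le_iff_le_add'.2 (h c hc)) (smul_nonneg hc.le hw)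
  exact sub_nonpos.1 (posPart_eq_zero.1 hpos)

theorem IsAtomElt.smul_le_or_le_smul {u v : E} (hu : IsAtomElt u) (hv₀ : 0 ≤ v)
    (hv : v ∈ disjCompl (disjCompl {u})) {t : ℝ} (ht : 0 ≤ t) :
    t • |u| ≤ v ∨ v ≤ t • |u| := by
  have hu₀ : 0 ≤ |u| := abs_nonneg u
  have htu : 0 ≤ t • |u| := smul_nonneg ht hu₀
  set w := t • |u| - v with hw
  have hwp := posPart_nonneg w
  have hwn := negPart_nonneg w
  have hdisj : (w⁺ ⊓ |u|) ⊓ (w⁻ ⊓ |u|) = 0 := inf_zero_mono (le_inf hwp hu₀) (le_inf hwn hu₀)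
    inf_le_left inf_le_left (posPart_inf_negPart_eq_zero w)
  rcases hu.2 _ _ (le_inf hwp hu₀) inf_le_right (le_inf hwn hu₀) inf_le_right hdisj with h | h
  · have hwu : Disj w⁺ |u| := by rwa [Disj, abs_abs, abs_of_nonneg hwp]
    have hle : |w⁺| ≤ |t • (|u|)| := by
      rw [abs_of_nonneg hwp, abs_of_nonneg htu]
      exact sup_le (sub_le_self _ hv₀) htu
    have hw₀ : w⁺ = 0 := (hwu.smul_right t).eq_zero_of_abs_le hle
    exact .inl (sub_nonpos.1 (posPart_eq_zero.1 hw₀))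
  · have hwu : w⁻ ∈ disjCompl {u} := by
      rintro _ rfl
      rwa [Disj, abs_of_nonneg hwn]
    have hle : |w⁻| ≤ |v| := by
      rw [abs_of_nonneg hwn, abs_of_nonneg hv₀, negPart_def, hw, neg_sub]
      exact sup_le (sub_le_self _ htu) hv₀
    have hw₀ : w⁻ = 0 := (hv _ hwu).symm.eq_zero_of_abs_le hle
    exact .inr (sub_nonneg.1 (negPart_eq_zero.1 hw₀))

theorem ProjectionProperty.exists_eq_smul_abs_of_nonneg (hE : ProjectionProperty E) {u v : E}
    (hu : IsAtomElt u) (hv₀ : 0 ≤ v) (hv : v ∈ disjCompl (disjCompl {u})) :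
    ∃ c : ℝ, v = c • |u| := by
  have hu₀ : 0 ≤ |u| := abs_nonneg u
  set A : Set ℝ := {t | 0 ≤ t ∧ t • |u| ≤ v}
  have hzero : (0 : ℝ) ∈ A := ⟨le_rfl, by rwa [zero_smul]⟩
  have hbdd : BddAbove A := by
    by_contra hunbdd
    refine hu.1 (hE.eq_zero_of_forall_abs_le_smul (y := v) fun c hc => ?_)
    obtain ⟨t, ht, hct⟩ := not_bddAbove_iff.1 hunbdd c⁻¹
    exact (inv_smul_le_iff_of_pos hc).1 ((smul_le_smul_of_nonneg_right hct.le hu₀).trans ht.2)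
  have hsup : 0 ≤ sSup A := le_csSup hbdd hzero
  refine ⟨sSup A, le_antisymm ?_ ?_⟩
  · refine hE.le_of_forall_le_add_smul hu₀ fun c hc => ?_
    rw [← add_smul]
    refine (hu.smul_le_or_le_smul hv₀ hv (by linarith)).resolve_left fun h => ?_
    have hle := le_csSup hbdd (show sSup A + c ∈ A from ⟨by linarith, h⟩)
    linarith
  · refine hE.le_of_forall_le_add_smul hu₀ fun c hc => ?_
    obtain ⟨t, ht, hlt⟩ := exists_lt_of_lt_csSup ⟨0, hzero⟩ (sub_lt_self (sSup A) hc)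
    calc sSup A • |u| ≤ (t + c) • |u| := smul_le_smul_of_nonneg_right (by linarith) hu₀
      _ = t • |u| + c • |u| := add_smul _ _ _
      _ ≤ v + c • |u| := add_le_add_left ht.2 _

theorem ProjectionProperty.mem_span_singleton (hE : ProjectionProperty E) {u v : E}
    (hu : IsAtomElt u) (hv : v ∈ disjCompl (disjCompl {u})) : v ∈ Submodule.span ℝ {u} := by
  have habs : |u| ∈ Submodule.span ℝ {u} := by
    have hmem := Submodule.mem_span_singleton_self (R := ℝ) u
    rcases hu.abs_eq with h | h
    · rwa [h]
    · rwa [h, Submodule.neg_mem_iff]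
  have hpos {w : E} (hw : 0 ≤ w) (hwv : w ≤ |v|) : w ∈ Submodule.span ℝ {u} := by
    have hw' : |w| ≤ |v| := (abs_of_nonneg hw).trans_le hwv
    obtain ⟨c, rfl⟩ := hE.exists_eq_smul_abs_of_nonneg hu hw (disjCompl_solid hv hw')
    exact Submodule.smul_mem _ c habs
  rw [← posPart_sub_negPart v]
  exact Submodule.sub_mem _ (hpos (posPart_nonneg v) (posPart_le_abs v))
    (hpos (negPart_nonneg v) (negPart_le_abs v))

theorem ProjectionProperty.mem_span_of_forall_isAtomElt (hE : ProjectionProperty E) {s : Finset E}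
    (hs : ∀ u ∈ s, IsAtomElt u) {x : E} (hx : x ∈ disjCompl (disjCompl (s : Set E))) :
    x ∈ Submodule.span ℝ (s : Set E) := by
  classical
  induction s using Finset.induction_on generalizing x with
  | empty => simp [Disj.eq_zero (hx x (by simp [disjCompl]))]
  | insert u s _ ih =>
    rw [Finset.forall_mem_insert] at hs
    obtain ⟨a, ha, b, hb, hab, rfl⟩ := hE.exists_add_eq {u} x
    rw [Finset.coe_insert, ← Set.union_singleton] at hx ⊢
    have has : a ∈ disjCompl (disjCompl (s : Set E)) :=
      mem_disjCompl_disjCompl_of_union (disjCompl_solid hx (isFragment_left hab).abs_le) ha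
    exact Submodule.add_mem _ (Submodule.span_mono Set.subset_union_left (ih hs.2 has))
      (Submodule.span_mono Set.subset_union_right (hE.mem_span_singleton hs.1 hb))

theorem ProjectionProperty.finiteDimensional_bandGenerated (hE : ProjectionProperty E)
    {s : Finset E} (hs : ∀ u ∈ s, IsAtomElt u) :
    FiniteDimensional ℝ (bandGenerated (s : Set E)) := by
  have hle : bandGenerated (s : Set E) ≤ Submodule.span ℝ (s : Set E) := fun _ hx =>
    hE.mem_span_of_forall_isAtomElt hs (bandGenerated_subset_disjCompl_disjCompl _ hx)
  exact Submodule.finiteDimensional_of_le hle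

theorem ProjectionProperty.isAtomElt_of_forall_isFragment (hE : ProjectionProperty E) {u : E}
    (hu : u ≠ 0) (h : ∀ f, IsFragment f u → f = 0 ∨ f = u) : IsAtomElt u := by
  refine ⟨hu, fun x y hx hxu hy hyu hxy => ?_⟩
  have hyx : Disj y x := by rwa [Disj, abs_of_nonneg hx, abs_of_nonneg hy, inf_comm]
  rw [← abs_of_nonneg hx] at hxu
  rw [← abs_of_nonneg hy] at hyu
  obtain ⟨a, ha, b, hb, hab, rfl⟩ := hE.exists_add_eq {x} u
  rcases h b (isFragment_right hab) with rfl | hbu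
  · rw [add_zero] at hxu
    exact .inl ((ha x rfl).symm.eq_zero_of_abs_le hxu)
  · rw [← hbu] at hyu
    have hymem : y ∈ disjCompl {x} := by
      rintro _ rfl
      exact hyx
    exact .inr ((hb y hymem).symm.eq_zero_of_abs_le hyu)

theorem ProjectionProperty.exists_latConv_of_mem_iUnion (hE : ProjectionProperty E)
    {T : ℕ → Set E} (hT : Monotone T) {g : E} (hg : g ∈ disjCompl (disjCompl (⋃ n, T n))) :
    ∃ b : ℕ → E, LatConv b g ∧ ∀ n, b n ∈ disjCompl (disjCompl (T n)) := by
  choose a ha b hb hab hg_eq using fun n => hE.exists_add_eq (T n) g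
  have hbg (n : ℕ) : IsFragment (b n) g := hg_eq n ▸ isFragment_right (hab n)
  have hsub (n : ℕ) : g - b n = a n := sub_eq_of_eq_add (hg_eq n).symm
  have hfrag (n m : ℕ) (hnm : n < m) : IsFragment (b n) (b m) := by
    have hdisj : Disj (b n) (a m) := hb n _ (disjCompl_anti (hT hnm.le) (ha m))
    rw [← hsub m] at hdisj
    simpa only [sub_sub_cancel] using (hbg n).sub_of_disj hdisj
  refine ⟨b, latConv_of_isGLB hfrag hbg ⟨?_, fun c hc => ?_⟩, hb⟩
  · rintro _ ⟨n, rfl⟩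
    exact abs_nonneg _
  · have hca (n : ℕ) : |c⁺| ≤ |a n| := by
      rw [abs_of_nonneg (posPart_nonneg c), ← hsub n]
      exact sup_le (hc ⟨n, rfl⟩) (abs_nonneg _)
    have hcT : c⁺ ∈ disjCompl (⋃ n, T n) := fun y hy => by
      obtain ⟨n, hn⟩ := Set.mem_iUnion.1 hy
      exact disjCompl_solid (ha n) (hca n) y hn
    have hcg : |c⁺| ≤ |g| := (hca 0).trans (hsub 0 ▸ (hbg 0).compl.abs_le)
    exact posPart_eq_zero.1 ((hg _ hcT).symm.eq_zero_of_abs_le hcg)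

end Bands

/-! ### Abstract Uryson functionals -/

section Functionals

variable {E : Type*} [AddCommGroup E] [Lattice E]

namespace UrysonSC

theorem map_fragment_add (T : UrysonSC E) {y x : E} (h : IsFragment y x) :
    T.1 y + T.1 (x - y) = T.1 x := by
  rw [← T.2.1 y (x - y) h, add_sub_cancel]

theorem tendsto_of_latConv (T : UrysonSC E) {x : ℕ → E} {a : E} (h : LatConv x a) :
    Tendsto (fun n => T.1 (x n)) atTop (𝓝 (T.1 a)) :=
  sigmaLaterallyContinuous_iff.1 T.2.2.2 x a h

theorem mono_fragment {p : UrysonSC E} (hp : 0 ≤ p) {y x : E} (h : IsFragment y x) :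
    p.1 y ≤ p.1 x :=
  (le_add_of_nonneg_right (hp (x - y))).trans_eq (map_fragment_add p h)

theorem map_fragment_eq_zero {p : UrysonSC E} (hp : 0 ≤ p) {y x : E} (h : IsFragment y x)
    (hx : p.1 x = 0) : p.1 y = 0 :=
  le_antisymm ((mono_fragment hp h).trans_eq hx) (hp y)

end UrysonSC

variable [IsOrderedAddMonoid E]

theorem exists_forall_abs_le {A : Set E} (hl : BddBelow A) (hu : BddAbove A) :
    ∃ w : E, ∀ x ∈ A, |x| ≤ w := by
  obtain ⟨l, hl⟩ := hl
  obtain ⟨u, hu⟩ := hu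
  refine ⟨|l| ⊔ |u|, fun x hx => abs_le'.2 ⟨?_, ?_⟩⟩
  · exact (hu hx).trans ((le_abs_self u).trans le_sup_right)
  · exact (neg_le_neg (hl hx)).trans ((neg_le_abs l).trans le_sup_left)

theorem orderBoundedMap_iff_forall_abs_le {T : E → ℝ} :
    OrderBoundedMap T ↔ ∀ w, ∃ K, ∀ x, |x| ≤ w → |T x| ≤ K := by
  rw [orderBoundedMap_iff]
  refine ⟨fun h w => h {x | |x| ≤ w} ⟨-w, fun _ hx => (bounds_of_abs_le hx).1⟩
    ⟨w, fun _ hx => (bounds_of_abs_le hx).2⟩, fun h A hl hu => ?_⟩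
  obtain ⟨w, hw⟩ := exists_forall_abs_le hl hu
  exact (h w).imp fun K hK x hx => hK x (hw x hx)

/-- `sup {T f : f ⊑ g, f ⊑ x}`: the positive part of `T`, restricted to the fragments of `g`.
It takes the place of `T⁺ (g ∧ x)`, as `g` and `x` need not have a greatest common fragment. -/
noncomputable def commonFragmentSup (T : E → ℝ) (g x : E) : ℝ :=
  sSup (T '' {f | IsFragment f g ∧ IsFragment f x})

theorem le_commonFragmentSup {T : E → ℝ} (hT : OrderBoundedMap T) {f g x : E}
    (hfg : IsFragment f g) (hfx : IsFragment f x) : T f ≤ commonFragmentSup T g x :=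
  le_csSup ((bddAbove_urysonPos hT g).mono (Set.image_mono fun _ h => h.1)) ⟨f, ⟨hfg, hfx⟩, rfl⟩

theorem commonFragmentSup_le {T : E → ℝ} {g x : E} {K : ℝ}
    (h : ∀ f, IsFragment f g → IsFragment f x → T f ≤ K) : commonFragmentSup T g x ≤ K := by
  refine csSup_le ⟨T 0, 0, ⟨isFragment_zero g, isFragment_zero x⟩, rfl⟩ ?_
  rintro _ ⟨f, ⟨hfg, hfx⟩, rfl⟩
  exact h f hfg hfx

theorem orthogonallyAdditive_commonFragmentSup {T : E → ℝ} (hT : OrthogonallyAdditive T)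
    (hTb : OrderBoundedMap T) (g : E) : OrthogonallyAdditive (commonFragmentSup T g) := by
  intro a b hab
  refine le_antisymm (commonFragmentSup_le fun f hfg hfx => ?_) ?_
  · have hdisj : Disj (common f a) (common f b) :=
      hab.mono (abs_common_le' _ _) (abs_common_le' _ _)
    have ha := isFragment_left hab
    have hb := isFragment_right hab
    rw [hfx.split hab, hT _ _ hdisj]
    exact add_le_add
      (le_commonFragmentSup hTb ((hfx.common_left ha).trans hfg) (hfx.common_right ha))
      (le_commonFragmentSup hTb ((hfx.common_left hb).trans hfg) (hfx.common_right hb))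
  · refine le_sub_iff_add_le.1 (commonFragmentSup_le fun f hfg hfa => ?_)
    refine le_sub_comm.1 (commonFragmentSup_le fun f' hfg' hfb => le_sub_iff_add_le'.2 ?_)
    have hdisj : Disj f f' := hab.mono hfa.abs_le hfb.abs_le
    rw [← hT f f' hdisj]
    exact le_commonFragmentSup hTb (hfg.add_of_disj hfg' hdisj) (hfa.add hab hfb)

theorem tendsto_commonFragmentSup {T : E → ℝ} (hTb : OrderBoundedMap T)
    (hTc : SigmaLaterallyContinuous T) (g : E) {x : ℕ → E} {a : E} (hx : LatConv x a) :
    Tendsto (fun n => commonFragmentSup T g (x n)) atTop (𝓝 (commonFragmentSup T g a)) := by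
  have hle (n : ℕ) : commonFragmentSup T g (x n) ≤ commonFragmentSup T g a :=
    commonFragmentSup_le fun f hfg hfx => le_commonFragmentSup hTb hfg (hfx.trans (hx.2.1 n))
  refine tendsto_order.2 ⟨fun b hb => ?_, fun b hb => .of_forall fun n => (hle n).trans_lt hb⟩
  have hne : (T '' {f | IsFragment f g ∧ IsFragment f a}).Nonempty :=
    ⟨T 0, 0, ⟨isFragment_zero g, isFragment_zero a⟩, rfl⟩
  obtain ⟨_, ⟨f, ⟨hfg, hfa⟩, rfl⟩, hbf⟩ := exists_lt_of_lt_csSup hne hb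
  have hlim := sigmaLaterallyContinuous_iff.1 hTc _ _ (hx.common hfa)
  filter_upwards [hlim.eventually (lt_mem_nhds hbf)] with n hn
  exact hn.trans_le (le_commonFragmentSup hTb ((hfa.common_left (hx.2.1 n)).trans hfg)
    (hfa.common_right (hx.2.1 n)))

namespace UrysonSC

theorem map_zero (T : UrysonSC E) : T.1 0 = 0 := by
  simpa using T.2.1 0 0 (disj_zero_right 0)

theorem map_sum_of_disj (T : UrysonSC E) {ι : Type*} {u : ι → E} {s : Finset ι}
    (hd : (s : Set ι).Pairwise fun i j => Disj (u i) (u j)) :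
    T.1 (∑ i ∈ s, u i) = ∑ i ∈ s, T.1 (u i) := by
  classical
  induction s using Finset.induction_on with
  | empty => simpa using map_zero T
  | insert i s hi ih =>
    rw [Finset.coe_insert, Set.pairwise_insert_of_notMem (by simpa using hi)] at hd
    have hdisj : Disj (u i) (∑ j ∈ s, u j) := disj_sum_right fun j hj => (hd.2 j hj).1
    rw [Finset.sum_insert hi, Finset.sum_insert hi, T.2.1 _ _ hdisj, ih hd.1]

theorem finite_setOf_abs_le {ι : Type*} (z : UrysonSC E) {δ : ℝ} (hδ : 0 < δ) {u : ι → E}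
    (hd : Pairwise fun i j => Disj (u i) (u j)) (hu : ∀ i, δ ≤ z.1 (u i)) (w : E) :
    {i | |u i| ≤ w}.Finite := by
  by_contra hinf
  obtain ⟨K, hK⟩ := orderBoundedMap_iff_forall_abs_le.1 z.2.2.1 w
  obtain ⟨n, hn⟩ := exists_nat_gt (K / δ)
  obtain ⟨s, hs, hcard⟩ := Set.Infinite.exists_subset_card_eq hinf n
  have hds : (s : Set ι).Pairwise fun i j => Disj (u i) (u j) := fun i _ j _ hij => hd hij
  have hw₀ : 0 ≤ w := by
    obtain ⟨i, hi⟩ := Set.Infinite.nonempty hinf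
    exact (abs_nonneg _).trans hi
  have hle : n * δ ≤ K := calc
    n * δ ≤ ∑ i ∈ s, z.1 (u i) := by
      simpa only [hcard, nsmul_eq_mul] using
        s.card_nsmul_le_sum (fun i => z.1 (u i)) δ fun i _ => hu i
    _ = z.1 (∑ i ∈ s, u i) := (map_sum_of_disj z hds).symm
    _ ≤ K := (le_abs_self _).trans (hK _ (abs_sum_le_of_disj hds hw₀ fun i hi => hs hi))
  exact hle.not_gt ((div_lt_iff₀ hδ).1 hn)

theorem commonFragmentSup_nonneg (T : UrysonSC E) (g x : E) : 0 ≤ commonFragmentSup T.1 g x :=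
  map_zero T ▸ le_commonFragmentSup T.2.2.1 (isFragment_zero g) (isFragment_zero x)

theorem commonFragmentSup_mem (T : UrysonSC E) (g : E) :
    commonFragmentSup T.1 g ∈ UrysonSC E := by
  refine ⟨orthogonallyAdditive_commonFragmentSup T.2.1 T.2.2.1 g, orderBoundedMap_iff.2
    fun _ _ _ => ⟨urysonPos T.1 g, fun x _ => ?_⟩, sigmaLaterallyContinuous_iff.2
    fun x a hx => tendsto_commonFragmentSup T.2.2.1 T.2.2.2 g hx⟩
  rw [abs_of_nonneg (commonFragmentSup_nonneg T g x)]
  exact commonFragmentSup_le fun f hfg _ => le_urysonPos T.2.2.1 hfg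

/-- The functional `x ↦ sup {T f : f ⊑ g, f ⊑ x}`. For `T ≥ 0` it is the part of `T` carried by
the fragments of `g`. -/
noncomputable def restrict (T : UrysonSC E) (g : E) : UrysonSC E :=
  ⟨commonFragmentSup T.1 g, commonFragmentSup_mem T g⟩

theorem restrict_nonneg (T : UrysonSC E) (g : E) : 0 ≤ restrict T g :=
  commonFragmentSup_nonneg T g

theorem restrict_le {p : UrysonSC E} (hp : 0 ≤ p) (g : E) : restrict p g ≤ p :=
  fun _ => commonFragmentSup_le fun _ _ hfx => mono_fragment hp hfx

theorem restrict_apply_le {p : UrysonSC E} (hp : 0 ≤ p) (g x : E) : (restrict p g).1 x ≤ p.1 g :=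
  commonFragmentSup_le fun _ hfg _ => mono_fragment hp hfg

theorem abs_mul_restrict_apply_le {p : UrysonSC E} (hp : 0 ≤ p) {t : ℝ} (ht : 0 ≤ t) (g x : E) :
    |t * (restrict p g).1 x| ≤ t * p.1 g := by
  rw [abs_of_nonneg (mul_nonneg ht (restrict_nonneg p g x))]
  exact mul_le_mul_of_nonneg_left (restrict_apply_le hp g x) ht

theorem restrict_apply_self {p : UrysonSC E} (hp : 0 ≤ p) (g : E) :
    (restrict p g).1 g = p.1 g :=
  le_antisymm (restrict_apply_le hp g g) (le_commonFragmentSup p.2.2.1 (.refl g) (.refl g))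

theorem restrict_apply_eq_zero_of_isAtomElt (T : UrysonSC E) {u x : E} (hu : IsAtomElt u)
    (hux : ¬ IsFragment u x) : (restrict T u).1 x = 0 := by
  refine le_antisymm (commonFragmentSup_le fun f hfu hfx => ?_) (restrict_nonneg T u x)
  rcases hu.eq_zero_or_eq hfu with rfl | rfl
  · exact (map_zero T).le
  · exact absurd hfx hux

end UrysonSC

end Functionals

/-! ### Majorants -/

section Majorants

/-- `z` is a majorant of `φ`: it witnesses that `φ` is a finite element. -/
def IsMajorant {L : Type*} [AddCommGroup L] [Lattice L] [Module ℝ L] (z φ : L) : Prop :=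
  ∀ x : L, ∃ c : ℝ, 0 < c ∧ ∀ n : ℕ, |x| ⊓ n • |φ| ≤ c • z

theorem IsMajorant.exists_forall_le_smul {L : Type*} [AddCommGroup L] [Lattice L] [Module ℝ L]
    {z φ : L} (hz : IsMajorant z φ) {ι : Type*} {T : ι → L} (hT : BddAbove (Set.range T))
    (hφ : ∀ k, ∃ n : ℕ, T k ≤ n • |φ|) : ∃ c : ℝ, 0 < c ∧ ∀ k, T k ≤ c • z := by
  obtain ⟨S, hS⟩ := hT
  obtain ⟨c, hc, h⟩ := hz S
  refine ⟨c, hc, fun k => ?_⟩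
  obtain ⟨n, hn⟩ := hφ k
  exact (le_inf ((hS ⟨k, rfl⟩).trans (le_abs_self S)) hn).trans (h n)

variable {E : Type*} [AddCommGroup E] [Lattice E] {ι : Type*}

/-- A family of functionals that is summable on every order interval `[-w, w]`, uniformly in the
sense of the Weierstrass `M`-test. -/
def SummableOnOrderIntervals (T : ι → UrysonSC E) : Prop :=
  ∀ w : E, ∃ M : ι → ℝ, Summable M ∧ ∀ k x, |x| ≤ w → |(T k).1 x| ≤ M k

theorem SummableOnOrderIntervals.summable {T : ι → UrysonSC E} (h : SummableOnOrderIntervals T)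
    (x : E) : Summable fun k => (T k).1 x := by
  obtain ⟨M, hM, hT⟩ := h |x|
  exact .of_norm_bounded hM fun k => hT k x le_rfl

variable [IsOrderedAddMonoid E]

theorem SummableOnOrderIntervals.tsum_mem {T : ι → UrysonSC E} (h : SummableOnOrderIntervals T) :
    (fun x => ∑' k, (T k).1 x) ∈ UrysonSC E := by
  refine ⟨fun x y hxy => ?_, orderBoundedMap_iff_forall_abs_le.2 fun w => ?_,
    sigmaLaterallyContinuous_iff.2 fun x a hx => ?_⟩
  · rw [← (h.summable x).tsum_add (h.summable y)]
    exact tsum_congr fun k => (T k).2.1 x y hxy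
  · obtain ⟨M, hM, hT⟩ := h w
    exact ⟨∑' k, M k, fun x hx => tsum_of_norm_bounded (f := fun k => (T k).1 x) hM.hasSum
      fun k => hT k x hx⟩
  · obtain ⟨M, hM, hT⟩ := h |a|
    exact tendsto_tsum_of_dominated_convergence hM (fun k => UrysonSC.tendsto_of_latConv (T k) hx)
      (.of_forall fun n k => hT k (x n) (hx.2.1 n).abs_le)

theorem SummableOnOrderIntervals.bddAbove_range {T : ι → UrysonSC E}
    (h : SummableOnOrderIntervals T) (hT : ∀ k, 0 ≤ T k) : BddAbove (Set.range T) := by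
  refine ⟨⟨_, h.tsum_mem⟩, ?_⟩
  rintro _ ⟨k, rfl⟩ x
  exact (h.summable x).le_tsum k fun j _ => hT j x

namespace IsMajorant

variable {p z : UrysonSC E}

theorem abs (hz : IsMajorant z p) : IsMajorant z |p| := by
  unfold IsMajorant
  rwa [abs_abs]

theorem nonneg (hz : IsMajorant z p) : 0 ≤ z := by
  obtain ⟨c, hc, h⟩ := hz.exists_forall_le_smul (T := fun _ : Unit => 0)
    (Set.finite_range _).bddAbove fun _ => ⟨0, (zero_smul ℕ _).ge⟩
  exact fun x => nonneg_of_mul_nonneg_right (h () x) hc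

theorem exists_forall_mul_apply_le (hz : IsMajorant z p) (hp : 0 ≤ p) {g : ι → E} {t : ι → ℝ}
    (ht : ∀ k, 0 ≤ t k) (hs : SummableOnOrderIntervals fun k => t k • UrysonSC.restrict p (g k)) :
    ∃ c : ℝ, 0 < c ∧ ∀ k, t k * p.1 (g k) ≤ c * z.1 (g k) := by
  have hbdd := hs.bddAbove_range fun k x => mul_nonneg (ht k) (UrysonSC.restrict_nonneg p (g k) x)
  obtain ⟨c, hc, h⟩ := hz.exists_forall_le_smul hbdd fun k => by
    obtain ⟨n, hn⟩ := exists_nat_ge (t k)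
    refine ⟨n, fun x => ?_⟩
    rw [abs_of_nonneg hp, ← Nat.cast_smul_eq_nsmul ℝ]
    exact mul_le_mul hn (UrysonSC.restrict_le hp (g k) x) (UrysonSC.restrict_nonneg p (g k) x)
      n.cast_nonneg
  refine ⟨c, hc, fun k => ?_⟩
  rw [← UrysonSC.restrict_apply_self hp]
  exact h k (g k)

theorem exists_pos_forall_le_apply (hz : IsMajorant z p) (hp : 0 ≤ p) :
    ∃ δ : ℝ, 0 < δ ∧ ∀ g, 0 < p.1 g → δ ≤ z.1 g := by
  by_contra! hcon
  choose g hg hgz using fun k : ℕ => hcon ((1 / 2 : ℝ) ^ k / (k + 1)) (by positivity)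
  have ht (k : ℕ) : 0 ≤ (1 / 2 : ℝ) ^ k / p.1 (g k) := div_nonneg (by positivity) (hp _)
  have hsum : SummableOnOrderIntervals
      fun k => ((1 / 2 : ℝ) ^ k / p.1 (g k)) • UrysonSC.restrict p (g k) := fun w => by
    refine ⟨fun k => (1 / 2 : ℝ) ^ k, summable_geometric_two, fun k x _ => ?_⟩
    exact (UrysonSC.abs_mul_restrict_apply_le hp (ht k) _ x).trans_eq
      (div_mul_cancel₀ _ (hg k).ne')
  obtain ⟨c, hc, h⟩ := hz.exists_forall_mul_apply_le hp ht hsum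
  obtain ⟨k, hk⟩ := exists_nat_gt c
  have hlt : (1 / 2 : ℝ) ^ k < (1 / 2 : ℝ) ^ k := calc
    (1 / 2 : ℝ) ^ k = (1 / 2 : ℝ) ^ k / p.1 (g k) * p.1 (g k) :=
        (div_mul_cancel₀ _ (hg k).ne').symm
    _ ≤ c * z.1 (g k) := h k
    _ < c * ((1 / 2 : ℝ) ^ k / (k + 1)) := mul_lt_mul_of_pos_left (hgz k) hc
    _ = (1 / 2 : ℝ) ^ k * (c / (k + 1)) := mul_div_left_comm _ _ _
    _ ≤ (1 / 2 : ℝ) ^ k := mul_le_of_le_one_right (by positivity)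
        ((div_le_one (by positivity)).2 (by linarith))
  exact hlt.false

theorem bddAbove_range_of_isAtomElt (hz : IsMajorant z p) (hp : 0 ≤ p) {u : ι → E}
    (hd : Pairwise fun i j => Disj (u i) (u j)) (hu : ∀ k, IsAtomElt (u k))
    (hpu : ∀ k, 0 < p.1 (u k)) {t : ι → ℝ} (ht : ∀ k, 0 ≤ t k) : BddAbove (Set.range t) := by
  classical
  obtain ⟨δ, hδ, hpz⟩ := hz.exists_pos_forall_le_apply hp
  have hzu (k : ι) : 0 < z.1 (u k) := hδ.trans_le (hpz _ (hpu k))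
  have htz (k : ι) : 0 ≤ t k * z.1 (u k) := mul_nonneg (ht k) (hzu k).le
  have hweight (k : ι) : 0 ≤ t k * z.1 (u k) / p.1 (u k) := div_nonneg (htz k) (hpu k).le
  have hcancel (k : ι) : t k * z.1 (u k) / p.1 (u k) * p.1 (u k) = t k * z.1 (u k) :=
    div_mul_cancel₀ _ (hpu k).ne'
  have hsum : SummableOnOrderIntervals
      fun k => (t k * z.1 (u k) / p.1 (u k)) • UrysonSC.restrict p (u k) := fun w => by
    have hfin := UrysonSC.finite_setOf_abs_le z hδ hd (fun k => hpz _ (hpu k)) w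
    refine ⟨fun k => if |u k| ≤ w then t k * z.1 (u k) else 0,
      summable_of_hasFiniteSupport (hfin.subset fun k hk => of_not_not fun h => hk (if_neg h)),
      fun k x hx => ?_⟩
    change |t k * z.1 (u k) / p.1 (u k) * (UrysonSC.restrict p (u k)).1 x| ≤
      if |u k| ≤ w then t k * z.1 (u k) else 0
    by_cases hux : IsFragment (u k) x
    · rw [if_pos (hux.abs_le.trans hx)]
      exact (UrysonSC.abs_mul_restrict_apply_le hp (hweight k) _ x).trans_eq (hcancel k)
    · rw [UrysonSC.restrict_apply_eq_zero_of_isAtomElt p (hu k) hux, mul_zero, abs_zero]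
      exact ite_nonneg (htz k) le_rfl
  obtain ⟨c, -, h⟩ := hz.exists_forall_mul_apply_le hp hweight hsum
  refine ⟨c, ?_⟩
  rintro _ ⟨k, rfl⟩
  have hk := h k
  rw [hcancel] at hk
  exact le_of_mul_le_mul_right hk (hzu k)

theorem finite_of_isAtomElt (hz : IsMajorant z p) (hp : 0 ≤ p) {A : Set E} (hd : A.Pairwise Disj)
    (hA : ∀ u ∈ A, IsAtomElt u ∧ 0 < p.1 u) : A.Finite := by
  by_contra hinf
  have := Set.Infinite.to_subtype hinf
  let u := Infinite.natEmbedding A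
  have hdu : Pairwise fun i j => Disj (u i : E) (u j) := fun i j hij =>
    hd (u i).2 (u j).2 fun h => hij (u.injective (Subtype.ext h))
  have hbdd : BddAbove (Set.range fun k : ℕ => (k : ℝ)) :=
    hz.bddAbove_range_of_isAtomElt hp hdu (fun k => (hA _ (u k).2).1) (fun k => (hA _ (u k).2).2)
      fun k => k.cast_nonneg
  exact not_bddAbove_of_tendsto_atTop tendsto_natCast_atTop_atTop hbdd

end IsMajorant

end Majorants

/-! ### Two-valued functionals -/

section TwoValued

variable {E : Type*} [AddCommGroup E] [Lattice E]

/-- `p` is two-valued on the fragments of `f`: in every decomposition of `f` into two fragments,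
one of the two is a null fragment. For `p ≥ 0` the only values are then `0` and `p f`. -/
def IsTwoValuedOn (p : UrysonSC E) (f : E) : Prop :=
  ∀ g, IsFragment g f → p.1 g = 0 ∨ p.1 (f - g) = 0

/-- `p` is null on the band `S^⊥⊥`, as far as the fragments of `f` are concerned. -/
def IsNullOn (p : UrysonSC E) (f : E) (S : Set E) : Prop :=
  ∀ g, IsFragment g f → g ∈ disjCompl (disjCompl S) → p.1 g = 0

variable {p : UrysonSC E} {f : E}

theorem IsNullOn.mono {S T : Set E} (hT : IsNullOn p f T) (h : S ⊆ T) : IsNullOn p f S :=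
  fun g hg hgS => hT g hg (disjCompl_anti (disjCompl_anti h) hgS)

variable [IsOrderedAddMonoid E]

theorem IsTwoValuedOn.of_isFragment (hp : 0 ≤ p) {e : E} (he : IsTwoValuedOn p e)
    (hf : IsFragment f e) : IsTwoValuedOn p f :=
  fun _ hg => (he _ (hg.trans hf)).imp_right
    (UrysonSC.map_fragment_eq_zero hp (hg.sub_right hf))

theorem exists_isTwoValuedOn {z : UrysonSC E} (hp : 0 ≤ p) (hz : 0 ≤ z) {δ : ℝ} (hδ : 0 < δ)
    (h : ∀ g, 0 < p.1 g → δ ≤ z.1 g) {e : E} (he : 0 < p.1 e) :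
    ∃ f, IsFragment f e ∧ 0 < p.1 f ∧ IsTwoValuedOn p f := by
  obtain ⟨N, hN⟩ := exists_nat_gt (z.1 e / δ)
  rw [div_lt_iff₀ hδ] at hN
  induction N generalizing e with
  | zero =>
    rw [Nat.cast_zero, zero_mul] at hN
    exact absurd (hz e) hN.not_ge
  | succ N ih =>
    by_cases htwo : IsTwoValuedOn p e
    · exact ⟨e, .refl e, he, htwo⟩
    · unfold IsTwoValuedOn at htwo
      push Not at htwo
      obtain ⟨g, hge, hg, hg'⟩ := htwo
      have hδz : δ ≤ z.1 (e - g) := h _ ((hp _).lt_of_ne' hg')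
      have hadd := UrysonSC.map_fragment_add z hge
      push_cast at hN
      obtain ⟨f, hf, hpf⟩ := ih ((hp g).lt_of_ne' hg) (by linarith)
      exact ⟨f, hf.trans hge, hpf⟩

theorem isNullOn_empty (p : UrysonSC E) (f : E) : IsNullOn p f ∅ := fun g _ hg => by
  rw [(hg g fun _ h => h.elim).eq_zero, UrysonSC.map_zero]

theorem isNullOn_singleton_abs (hp : 0 ≤ p) {a : E} (ha : IsFragment a f) (hpa : p.1 a = 0) :
    IsNullOn p f {|a|} := by
  intro g hg hga
  have hdisj : Disj g (f - a) := hga _ (by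
    rintro _ rfl
    exact disj_abs_right.2 ha.symm)
  refine UrysonSC.map_fragment_eq_zero hp ?_ hpa
  simpa only [sub_sub_cancel] using hg.sub_of_disj hdisj

theorem IsTwoValuedOn.isNullOn_of_subset_disjCompl (hp : 0 ≤ p) (htwo : IsTwoValuedOn p f)
    {S T : Set E} (hST : T ⊆ disjCompl S) (hS : ¬ IsNullOn p f S) : IsNullOn p f T := by
  unfold IsNullOn at hS
  push Not at hS
  obtain ⟨g, hgf, hgS, hpg⟩ := hS
  intro k hkf hkT
  have hgk : Disj k g := hkT g (disjCompl_anti hST hgS)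
  exact UrysonSC.map_fragment_eq_zero hp (hkf.sub_of_disj hgk) ((htwo g hgf).resolve_left hpg)

variable [Module ℝ E] [IsOrderedModule ℝ E]

namespace IsNullOn

theorem union (hE : ProjectionProperty E) {S T : Set E} (hS : IsNullOn p f S)
    (hT : IsNullOn p f T) : IsNullOn p f (S ∪ T) := by
  intro g hg hgu
  obtain ⟨a, ha, b, hb, hab, rfl⟩ := hE.exists_add_eq T g
  have hag := isFragment_left hab
  have haS := mem_disjCompl_disjCompl_of_union (disjCompl_solid hgu hag.abs_le) ha
  have hbg := isFragment_right hab
  rw [p.2.1 a b hab, hS a (hag.trans hg) haS, hT b (hbg.trans hg) hb, add_zero]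

theorem iUnion_of_monotone (hE : ProjectionProperty E) {T : ℕ → Set E} (hT : Monotone T)
    (h : ∀ n, IsNullOn p f (T n)) : IsNullOn p f (⋃ n, T n) := by
  intro g hg hgT
  obtain ⟨b, hb, hbT⟩ := hE.exists_latConv_of_mem_iUnion hT hgT
  have hzero (n : ℕ) : p.1 (b n) = 0 := h n _ ((hb.2.1 n).trans hg) (hbT n)
  have hlim := UrysonSC.tendsto_of_latConv p hb
  simp only [hzero] at hlim
  exact tendsto_nhds_unique hlim tendsto_const_nhds

theorem iUnion (hE : ProjectionProperty E) {S : ℕ → Set E} (h : ∀ n, IsNullOn p f (S n)) :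
    IsNullOn p f (⋃ n, S n) := by
  rw [← Set.iUnion_accumulate]
  refine iUnion_of_monotone hE Set.monotone_accumulate fun n => ?_
  induction n with
  | zero => simpa only [Set.accumulate_zero_nat] using h 0
  | succ n ih =>
    rw [Set.accumulate_succ]
    exact ih.union hE (h (n + 1))

theorem sUnion (hE : ProjectionProperty E) {C : Set (Set E)} (hC : C.Countable)
    (h : ∀ s ∈ C, IsNullOn p f s) : IsNullOn p f (⋃₀ C) := by
  rcases C.eq_empty_or_nonempty with rfl | hne
  · simpa only [Set.sUnion_empty] using isNullOn_empty p f
  · obtain ⟨S, rfl⟩ := hC.exists_eq_range hne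
    rw [Set.sUnion_range]
    exact iUnion hE fun n => h _ ⟨n, rfl⟩

end IsNullOn

/-- The filter on `A` of the sets whose complement spans a null band. It is countably complete,
and it is an ultrafilter if `A` is disjoint and `p` is two-valued on `f` but not null on `A`. -/
def coNullFilter (hE : ProjectionProperty E) (p : UrysonSC E) (f : E) (A : Set E) : Filter A :=
  Filter.ofCountableUnion {s | IsNullOn p f ((↑) '' s)}
    (fun C hC h => by
      rw [Set.mem_ofPred_eq, Set.image_sUnion]
      exact .sUnion hE (hC.image _) (Set.forall_mem_image.2 h))
    fun _ ht _ hst => ht.mono (Set.image_mono hst)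

theorem mem_coNullFilter {hE : ProjectionProperty E} {A : Set E} {s : Set A} :
    s ∈ coNullFilter hE p f A ↔ IsNullOn p f ((↑) '' sᶜ) :=
  Iff.rfl

theorem countableInterFilter_coNullFilter (hE : ProjectionProperty E) (p : UrysonSC E) (f : E)
    (A : Set E) : CountableInterFilter (coNullFilter hE p f A) :=
  Filter.countableInter_ofCountableUnion _ _ _

namespace IsTwoValuedOn

theorem compl_notMem_coNullFilter_iff (hE : ProjectionProperty E) (hp : 0 ≤ p)
    (htwo : IsTwoValuedOn p f) {A : Set E} (hd : A.Pairwise Disj) (hA : ¬ IsNullOn p f A)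
    (s : Set A) : sᶜ ∉ coNullFilter hE p f A ↔ s ∈ coNullFilter hE p f A := by
  rw [mem_coNullFilter, mem_coNullFilter, compl_compl]
  refine ⟨htwo.isNullOn_of_subset_disjCompl hp ?_, fun hsc hs => hA ?_⟩
  · rintro _ ⟨a, ha, rfl⟩ _ ⟨b, hb, rfl⟩
    exact hd a.2 b.2 fun h => ha (Subtype.ext h ▸ hb)
  · have hunion := hs.union hE hsc
    rwa [← Set.image_union, Set.union_compl_self, Set.image_univ, Subtype.range_coe] at hunion

theorem isNullOn_of_isNonmeasurable (hE : ProjectionProperty E) (hp : 0 ≤ p)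
    (htwo : IsTwoValuedOn p f) {A : Set E} (hd : A.Pairwise Disj) (hcard : IsNonmeasurable A)
    (hnull : ∀ a ∈ A, IsNullOn p f {a}) : IsNullOn p f A := by
  by_contra hA
  obtain ⟨a, ha⟩ := hcard
    (.ofComplNotMemIff _ (htwo.compl_notMem_coNullFilter_iff hE hp hd hA))
    (countableInterFilter_coNullFilter hE p f A)
  have hmem : {a}ᶜ ∈ coNullFilter hE p f A := by
    rw [mem_coNullFilter, compl_compl, Set.image_singleton]
    exact hnull a a.2
  have hpure : {a}ᶜ ∈ (pure a : Ultrafilter A) := ha ▸ hmem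
  exact hpure rfl

theorem exists_isFragment_forall_eq_zero (hE : ProjectionProperty E)
    (hcard : ∀ A : Set E, A.Pairwise Disj → (∀ a ∈ A, 0 ≤ a) → BddAbove A → IsNonmeasurable A)
    (hp : 0 ≤ p) (htwo : IsTwoValuedOn p f) :
    ∃ u, IsFragment u f ∧ p.1 u = p.1 f ∧ ∀ g, IsFragment g u → p.1 g = 0 → g = 0 := by
  obtain ⟨A, hA, hd, hmax⟩ := exists_maximal_pairwise_disj {a | ∃ g, IsFragment g f ∧
    p.1 g = 0 ∧ |g| = a}
  have hA₀ : ∀ a ∈ A, 0 ≤ a := fun a ha => by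
    obtain ⟨g, -, -, rfl⟩ := hA ha
    exact abs_nonneg g
  have hAf : ∀ a ∈ A, a ≤ |f| := fun a ha => by
    obtain ⟨g, hg, -, rfl⟩ := hA ha
    exact hg.abs_le
  have hnull : ∀ a ∈ A, IsNullOn p f {a} := fun a ha => by
    obtain ⟨g, hg, hpg, rfl⟩ := hA ha
    exact isNullOn_singleton_abs hp hg hpg
  have hAnull : IsNullOn p f A :=
    htwo.isNullOn_of_isNonmeasurable hE hp hd (hcard A hd hA₀ ⟨|f|, hAf⟩) hnull
  obtain ⟨u, hu, v, hv, huv, rfl⟩ := hE.exists_add_eq A f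
  refine ⟨u, isFragment_left huv, ?_, fun g hg hpg => ?_⟩
  · rw [p.2.1 u v huv, hAnull v (isFragment_right huv) hv, add_zero]
  · have hgA : |g| ∈ disjCompl A := disjCompl_solid hu ((abs_abs g).trans_le hg.abs_le)
    have hgf := hg.trans (isFragment_left huv)
    exact eq_zero_of_abs_eq_zero (hmax _ ⟨g, hgf, hpg, rfl⟩ hgA)

theorem exists_isAtomElt (hE : ProjectionProperty E)
    (hcard : ∀ A : Set E, A.Pairwise Disj → (∀ a ∈ A, 0 ≤ a) → BddAbove A → IsNonmeasurable A)
    (hp : 0 ≤ p) (htwo : IsTwoValuedOn p f) (hf : 0 < p.1 f) :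
    ∃ u, IsFragment u f ∧ IsAtomElt u ∧ 0 < p.1 u := by
  obtain ⟨u, huf, hpu, hmin⟩ := htwo.exists_isFragment_forall_eq_zero hE hcard hp
  have hu₀ : u ≠ 0 := by
    rintro rfl
    rw [UrysonSC.map_zero] at hpu
    exact hf.ne hpu
  refine ⟨u, huf, hE.isAtomElt_of_forall_isFragment hu₀ fun g hg => ?_, hf.trans_eq hpu.symm⟩
  exact (htwo.of_isFragment hp huf g hg).imp (hmin g hg)
    fun h => (sub_eq_zero.1 (hmin _ hg.compl h)).symm

end IsTwoValuedOn

theorem IsMajorant.exists_isAtomElt (hE : ProjectionProperty E)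
    (hcard : ∀ A : Set E, A.Pairwise Disj → (∀ a ∈ A, 0 ≤ a) → BddAbove A → IsNonmeasurable A)
    {z : UrysonSC E} (hz : IsMajorant z p) (hp : 0 ≤ p) {x : E} (hx : 0 < p.1 x) :
    ∃ u, IsFragment u x ∧ IsAtomElt u ∧ 0 < p.1 u := by
  obtain ⟨δ, hδ, hpz⟩ := hz.exists_pos_forall_le_apply hp
  obtain ⟨f, hfx, hpf, htwo⟩ := exists_isTwoValuedOn hp hz.nonneg hδ hpz hx
  obtain ⟨u, huf, hu⟩ := htwo.exists_isAtomElt hE hcard hp hpf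
  exact ⟨u, huf.trans hfx, hu⟩

end TwoValued

end VL

theorem theorem4p11 {E : Type*} [AddCommGroup E] [Lattice E] [IsOrderedAddMonoid E]
    [Module ℝ E] [IsOrderedModule ℝ E]
    (hE : VL.ProjectionProperty E)
    (hcard : ∀ A : Set E, A.Pairwise VL.Disj → (∀ a ∈ A, 0 ≤ a) → BddAbove A →
      VL.IsNonmeasurable A)
    (φ : VL.UrysonSC E) (hφ : VL.IsFiniteElement φ) :
    ∃ s : Finset E,
      (∀ u ∈ s, VL.IsAtomElt u) ∧
      (s : Set E).Pairwise VL.Disj ∧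
      VL.IsProjectionBand (VL.bandGenerated (s : Set E)) ∧
      FiniteDimensional ℝ (VL.bandGenerated (s : Set E)) ∧
      ∀ x ∈ VL.disjCompl (VL.bandGenerated (s : Set E) : Set E), (φ : E → ℝ) x = 0 := by
  obtain ⟨z, hz⟩ : ∃ z, VL.IsMajorant z φ := hφ
  obtain ⟨A, hA, hd, hmax⟩ :=
    VL.exists_maximal_pairwise_disj {u | VL.IsAtomElt u ∧ 0 < (|φ| : VL.UrysonSC E).1 u}
  lift A to Finset E using hz.abs.finite_of_isAtomElt (abs_nonneg φ) hd hA
  refine ⟨A, fun u hu => (hA hu).1, hd, hE _ (VL.isBand_bandGenerated _),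
    hE.finiteDimensional_bandGenerated fun u hu => (hA hu).1, fun x hx => ?_⟩
  by_contra hne
  have hle : |φ.1 x| ≤ (|φ| : VL.UrysonSC E).1 x := abs_le'.2 ⟨le_abs_self φ x, neg_le_abs φ x⟩
  obtain ⟨u, hux, hu⟩ :=
    hz.abs.exists_isAtomElt hE hcard (abs_nonneg φ) ((abs_pos.2 hne).trans_le hle)
  have huA : u ∈ VL.disjCompl (A : Set E) :=
    VL.disjCompl_solid (VL.disjCompl_anti (VL.subset_bandGenerated _) hx) hux.abs_le
  exact hu.1.1 (hmax u hu huA)
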